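/- Let $\mathbb{S}^n$ be the space of real symmetric $n\times n$ matrices with the Frobenius norm $\|\cdot\|$ (products of copies of $\mathbb{S}^n$ carry the Euclidean product norm), let $\mathbb{S}^n_+$ be the cone of positive semidefinite matrices and $\mathbb{N}^n$ the cone of entrywise nonnegative matrices, let $\Pi_C$ denote the metric projection onto a closed convex set $C\subseteq\mathbb{S}^n$ (with $\Pi_{\mathbb{N}^n}$ the projection onto $\mathbb{S}^n\cap\mathbb{N}^n$), and fix $G\in\mathbb{S}^n$. Consider the projection problem $$(\mathbf{P})\quad \min_{X\in\mathbb{S}^n}\ \tfrac12\|X-G\|^2\quad\text{s.t. } X\in\mathbb{S}^n_+,\ X\in\mathbb{N}^n ,$$ and its dual (up to sign) $$(\mathbf{D})\quad \min_{S,Z\in\mathbb{S}^n}\ \varphi(S,Z):=\tfrac12\|S+Z+G\|^2-\tfrac12\|G\|^2\quad\text{s.t. } S\in\mathbb{S}^n_+,\ Z\in\mathbb{N}^n ,$$ with solution set $\mathrm{SOL}_{\rm D}$ of $(\mathbf{D})$. Put $$\mathrm{Res}(X,S,Z):=\big(X-G-S-Z,\ X-\Pi_{\mathbb{S}^n_+}(X-S),\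 X-\Pi_{\mathbb{N}^n}(X-Z)\big),$$ $$L_\sigma(X;S,Z):=\tfrac12\|X-G\|^2+\tfrac1{2\sigma}\big(\|\Pi_{\mathbb{S}^n_+}(S-\sigma X)\|^2+\|\Pi_{\mathbb{N}^n}(Z-\sigma X)\|^2\big).$$ Let $(\sigma_k)$ be a nondecreasing sequence of positive reals with limit $\sigma_\infty\le+\infty$, and let $(\varepsilon_k)$ and $(\eta_k)$ be summable sequences of positive reals. Let $(X^k,S^k,Z^k)_{k\ge0}$ be a sequence in $\mathbb{S}^n\times\mathbb{S}^n\times\mathbb{S}^n$ generated by the inexact augmented Lagrangian method, that is, with $f_k:=L_{\sigma_k}(\cdot\,;S^k,Z^k)$, for all $k\ge0$, $$S^{k+1}=\Pi_{\mathbb{S}^n_+}(S^k-\sigma_kX^{k+1}),\qquad Z^{k+1}=\Pi_{\mathbb{N}^n}(Z^k-\sigma_kX^{k+1}),$$ where $X^{k+1}$ is an approximate minimizer of $f_k$ satisfying the stopping criterion $$(A')\quad \|\nabla f_k(X^{k+1})\|\le\varepsilon_k/\sqrt{\sigma_k}.$$ Then the sequence $(X^k,S^k,Z^k)$ is bounded,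 $(\mathbf{P})$ has a unique solution $X^\infty$ and $X^k\to X^\infty$, and $(S^k,Z^k)$ converges to some $(S^\infty,Z^\infty)\in\mathrm{SOL}_{\rm D}$. Suppose moreover that for all $k\ge0$ $$(B')\quad \|\nabla f_k(X^{k+1})\|\le\frac{\eta_k}{\sqrt{\sigma_k}}\,\big\|(S^{k+1}-S^k,Z^{k+1}-Z^k)\big\| ,$$ and that the quadratic growth condition for $(\mathbf{D})$ holds at $(S^\infty,Z^\infty)$ with modulus $\kappa>0$: for some $r>0$, $\varphi(S,Z)\ge\varphi(S^\infty,Z^\infty)+\kappa\,\mathrm{dist}^2\big((S,Z),\mathrm{SOL}_{\rm D}\big)$ for all $S\in\mathbb{S}^n_+$, $Z\in\mathbb{S}^n\cap\mathbb{N}^n$ with $\|(S,Z)-(S^\infty,Z^\infty)\|\le r$. Then there is $k_0\ge0$ such that for all $k\ge k_0$ one has $\eta_k<1$, $$\mathrm{dist}\big((S^{k+1},Z^{k+1}),\mathrm{SOL}_{\rm D}\big)\le\mu_k\,\mathrm{dist}\big((S^k,Z^k),\mathrm{SOL}_{\rm D}\big),$$ $$\|\mathrm{Res}(X^{k+1},S^{k+1},Z^{k+1})\|\le\mu_k'\,\mathrm{dist}\big((S^k,Z^k),\mathrm{SOL}_{\rm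 D}\big),$$ where $$\mu_k:=\frac{\eta_k+(\eta_k+1)/\sqrt{1+\sigma_k^2\kappa^2}}{1-\eta_k}\to\mu_\infty:=\frac1{\sqrt{1+\sigma_\infty^2\kappa^2}},\qquad \mu_k':=\frac{\eta_k/\sqrt{\sigma_k}+2/\sigma_k}{1-\eta_k}\to\mu'_\infty:=\frac2{\sigma_\infty},$$ and $\mu_\infty=\mu'_\infty=0$ if $\sigma_\infty=+\infty$. -/

import Mathlib

open Filter Topology

noncomputable section

namespace DNN

/-- The metric projection `Π_D(x) = argmin {‖x - d‖ | d ∈ D}`; it is only used for nonempty closed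
convex sets `D`, where the minimizer exists and is unique. -/
def metricProj {E : Type*} [NormedAddCommGroup E] (D : Set E) (x : E) : E :=
  Classical.epsilon fun p => p ∈ D ∧ ∀ d ∈ D, ‖x - p‖ ≤ ‖x - d‖

/-- Symmetric `n × n` matrices, as a subspace of `ℝ^{n × n}` with the Euclidean structure of the
entries. -/
def symSubspace (n : ℕ) : Submodule ℝ (EuclideanSpace ℝ (Fin n × Fin n)) where
  carrier := {x | ∀ i j, x (i, j) = x (j, i)}
  add_mem' := fun {a b} ha hb i j => by
    simp only [Set.mem_ofPred_eq] at ha hb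
    simp [ha i j, hb i j]
  zero_mem' := fun i j => by simp
  smul_mem' := fun c x hx i j => by
    simp only [Set.mem_ofPred_eq] at hx
    simp [hx i j]

/-- The Euclidean space `𝕊ⁿ` of symmetric `n × n` matrices; its norm is the Frobenius norm. -/
abbrev SymMat (n : ℕ) : Type := symSubspace n

/-- The matrix with the entries of an element of `𝕊ⁿ`. -/
def SymMat.toMatrix {n : ℕ} (X : SymMat n) : Matrix (Fin n) (Fin n) ℝ :=
  Matrix.of fun i j => X.1 (i, j)

/-- The cone `𝕊ⁿ₊` of positive semidefinite matrices. -/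
def psdCone (n : ℕ) : Set (SymMat n) := {X | X.toMatrix.PosSemidef}

/-- The cone of entrywise nonnegative symmetric matrices. -/
def nonnegCone (n : ℕ) : Set (SymMat n) := {X | ∀ i j, 0 ≤ X.toMatrix i j}

/-- The doubly nonnegative cone. -/
def dnnCone (n : ℕ) : Set (SymMat n) := psdCone n ∩ nonnegCone n

/-- The Euclidean product `𝕊ⁿ × 𝕊ⁿ`, with `‖(S, Z)‖² = ‖S‖² + ‖Z‖²`. -/
abbrev SymPair (n : ℕ) : Type := WithLp 2 (SymMat n × SymMat n)

/-- The pair `(S, Z)` as a point of the Euclidean product. -/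
def pair {n : ℕ} (S Z : SymMat n) : SymPair n := WithLp.toLp 2 (S, Z)

/-- The solution set of the primal problem `min {½‖X - G‖² | X ∈ 𝕊ⁿ₊, X ≥ 0}`. -/
def solP {n : ℕ} (G : SymMat n) : Set (SymMat n) :=
  {X | X ∈ dnnCone n ∧ IsMinOn (fun Y : SymMat n => (1 / 2 : ℝ) * ‖Y - G‖ ^ 2) (dnnCone n) X}

/-- The feasible set of the dual problem. -/
def dualFeasible (n : ℕ) : Set (SymPair n) := {y | y.fst ∈ psdCone n ∧ y.snd ∈ nonnegCone n}

/-- The function `½‖S + Z + G‖² - ½‖G‖²` minimized in the dual problem. -/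
def dualObj {n : ℕ} (G : SymMat n) (y : SymPair n) : ℝ :=
  (1 / 2 : ℝ) * ‖y.fst + y.snd + G‖ ^ 2 - (1 / 2 : ℝ) * ‖G‖ ^ 2

/-- The solution set of the dual problem. -/
def solD {n : ℕ} (G : SymMat n) : Set (SymPair n) :=
  {y | y ∈ dualFeasible n ∧ IsMinOn (dualObj G) (dualFeasible n) y}

/-- The quadratic growth condition of the dual problem at `y` with modulus `κ`. -/
def DualQuadraticGrowth {n : ℕ} (G : SymMat n) (y : SymPair n) (κ : ℝ) : Prop :=
  0 < κ ∧ ∃ r > 0, ∀ w ∈ Metric.closedBall y r ∩ dualFeasible n,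
    dualObj G y + κ * Metric.infDist w (solD G) ^ 2 ≤ dualObj G w

/-- The KKT residual map, with values in a Euclidean product of three copies of `𝕊ⁿ`. -/
def kktRes {n : ℕ} (X S Z : SymMat n) (G : SymMat n) :
    WithLp 2 (SymMat n × WithLp 2 (SymMat n × SymMat n)) :=
  WithLp.toLp 2 (X - G - S - Z,
    WithLp.toLp 2 (X - metricProj (psdCone n) (X - S), X - metricProj (nonnegCone n) (X - Z)))

/-- The augmented Lagrangian function `L_σ(X; S, Z)`. -/
def augLag {n : ℕ} (G : SymMat n) (σ : ℝ) (S Z X : SymMat n) : ℝ :=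
  (1 / 2 : ℝ) * ‖X - G‖ ^ 2 + 1 / (2 * σ) *
    (‖metricProj (psdCone n) (S - σ • X)‖ ^ 2 + ‖metricProj (nonnegCone n) (Z - σ • X)‖ ^ 2)

/-- The multiplier updates of the augmented Lagrangian method. -/
def IsALMUpdate {n : ℕ} (σ : ℕ → ℝ) (X S Z : ℕ → SymMat n) : Prop :=
  ∀ k, S (k + 1) = metricProj (psdCone n) (S k - σ k • X (k + 1)) ∧
    Z (k + 1) = metricProj (nonnegCone n) (Z k - σ k • X (k + 1))

/-- Criterion `‖∇ f_k(X^{k+1})‖ ≤ ε_k / √σ_k`, with `f_k = L_{σ_k}(·; S^k, Z^k)`. -/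
def CriterionA {n : ℕ} (G : SymMat n) (σ ε : ℕ → ℝ) (X S Z : ℕ → SymMat n) : Prop :=
  ∀ k, ‖gradient (augLag G (σ k) (S k) (Z k)) (X (k + 1))‖ ≤ ε k / √(σ k)

/-- Criterion `‖∇ f_k(X^{k+1})‖ ≤ (η_k / √σ_k) ‖(S^{k+1} - S^k, Z^{k+1} - Z^k)‖`. -/
def CriterionB {n : ℕ} (G : SymMat n) (σ η : ℕ → ℝ) (X S Z : ℕ → SymMat n) : Prop :=
  ∀ k, ‖gradient (augLag G (σ k) (S k) (Z k)) (X (k + 1))‖ ≤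
    (η k / √(σ k)) * ‖pair (S (k + 1) - S k) (Z (k + 1) - Z k)‖

/-- The rate `μ_k` as a function of `η_k`, `σ_k` and `κ`. -/
def mu (κ η σ : ℝ) : ℝ := (η + (η + 1) / √(1 + σ ^ 2 * κ ^ 2)) / (1 - η)

/-- The rate `μ'_k` as a function of `η_k` and `σ_k`. -/
def mu' (η σ : ℝ) : ℝ := (η / √σ + 2 / σ) / (1 - η)

end DNN

end

/-! The augmented Lagrangian method is an inexact proximal point method on the dual. With `e =
∇f_k(X^{k+1}) = X^{k+1} - G - S^{k+1} - Z^{k+1}`, eliminating `X^{k+1}` from the two projections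
turns the multiplier update into a proximal step for the dual objective whose gradient is perturbed
by `e` (`isProxStep_of_update`). All cones involved are self-dual, which supplies Moreau
decompositions, gradients and complementarity.

The curvature of the quadratic absorbs `e`, so one step changes the squared distance to any dual
solution by at most `σ‖e‖² ≤ ε²`, which is summable (`IsProxStep.norm_sq_add_norm_sq_le`). This
quasi-Fejér property gives dual convergence; then `X = S + Z + G + e` converges because `e → 0`, and
duality identifies the limit.

For the rates, the step is compared with the exact proximal step from the same point, at distance at
most `√σ‖e‖`. Quadratic growth makes the exact step contract by `1/√(1 + σ²κ²)`
(`IsProxStep.infDist_le`), and (B') bounds the discrepancy by `η` times the step length. -/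

open scoped RealInnerProductSpace

noncomputable section

namespace DNN

/-! ### Projections onto self-dual cones. -/

section Cone

variable {E : Type*} [NormedAddCommGroup E] [InnerProductSpace ℝ E]

/-- A set that equals its own dual cone. -/
def IsSelfDual (K : Set E) : Prop := ∀ x, x ∈ K ↔ ∀ y ∈ K, 0 ≤ ⟪x, y⟫

namespace IsSelfDual

variable {K : Set E}

theorem inner_nonneg (hK : IsSelfDual K) {x y : E} (hx : x ∈ K) (hy : y ∈ K) : 0 ≤ ⟪x, y⟫ := (hK x).1 hx y hy

theorem zero_mem (hK : IsSelfDual K) : (0 : E) ∈ K := (hK 0).2 fun y _ => by simp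

theorem add_mem (hK : IsSelfDual K) {x y : E} (hx : x ∈ K) (hy : y ∈ K) : x + y ∈ K :=
  (hK _).2 fun z hz => by
    rw [inner_add_left]
    exact add_nonneg (hK.inner_nonneg hx hz) (hK.inner_nonneg hy hz)

theorem smul_mem (hK : IsSelfDual K) {x : E} {t : ℝ} (ht : 0 ≤ t) (hx : x ∈ K) : t • x ∈ K :=
  (hK _).2 fun z hz => by
    rw [real_inner_smul_left]
    exact mul_nonneg ht (hK.inner_nonneg hx hz)

theorem convex (hK : IsSelfDual K) : Convex ℝ K := fun _ hx _ hy _ _ ha hb _ =>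
  hK.add_mem (hK.smul_mem ha hx) (hK.smul_mem hb hy)

theorem isClosed (hK : IsSelfDual K) : IsClosed K := by
  have h : K = ⋂ y ∈ K, {x | 0 ≤ ⟪x, y⟫} := by
    ext x
    simp only [Set.mem_iInter, Set.mem_ofPred_eq]
    exact hK x
  rw [h]
  exact isClosed_biInter fun y _ => isClosed_le continuous_const (by fun_prop)

/-- A point of `K` at which `w` satisfies the variational inequality over `K` is complementary to
`w`, and `w` lies in `K`. -/
theorem complementarity (hK : IsSelfDual K) {w p : E} (hp : p ∈ K) (h : ∀ c ∈ K, 0 ≤ ⟪w, c - p⟫) :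
    w ∈ K ∧ ⟪w, p⟫ = 0 := by
  -- Testing at `0` and at `2p` bounds `⟪w, p⟫` from both sides.
  have h0 := h 0 hK.zero_mem
  have h2 := h (p + p) (hK.add_mem hp hp)
  rw [zero_sub, inner_neg_right] at h0
  rw [add_sub_cancel_right] at h2
  have hwp : ⟪w, p⟫ = 0 := le_antisymm (by linarith) h2
  refine ⟨(hK w).2 fun c hc => ?_, hwp⟩
  have := h c hc
  rwa [inner_sub_right, hwp, sub_zero] at this

variable [FiniteDimensional ℝ E]

theorem metricProj_spec (hK : IsSelfDual K) (x : E) :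
    metricProj K x ∈ K ∧ ∀ c ∈ K, ⟪x - metricProj K x, c - metricProj K x⟫ ≤ 0 := by
  have hne : K.Nonempty := ⟨0, hK.zero_mem⟩
  obtain ⟨p, hp, hpx⟩ := hK.isClosed.exists_infDist_eq_dist hne x
  have hs : metricProj K x ∈ K ∧ ∀ d ∈ K, ‖x - metricProj K x‖ ≤ ‖x - d‖ :=
    Classical.epsilon_spec (p := fun p => p ∈ K ∧ ∀ d ∈ K, ‖x - p‖ ≤ ‖x - d‖)
      ⟨p, hp, fun d hd => by
        rw [← dist_eq_norm, ← dist_eq_norm, ← hpx]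
        exact Metric.infDist_le_dist_of_mem hd⟩
  refine ⟨hs.1, (norm_eq_iInf_iff_real_inner_le_zero hK.convex hs.1).1 ?_⟩
  have : Nonempty K := ⟨⟨0, hK.zero_mem⟩⟩
  refine le_antisymm (le_ciInf fun d => hs.2 d d.2) ?_
  exact ciInf_le ⟨0, by rintro _ ⟨d, rfl⟩; exact norm_nonneg _⟩
    (⟨metricProj K x, hs.1⟩ : K)

theorem metricProj_mem (hK : IsSelfDual K) (x : E) : metricProj K x ∈ K := (hK.metricProj_spec x).1

/-- Moreau's decomposition of `x` along `K`. -/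
theorem metricProj_moreau (hK : IsSelfDual K) (x : E) :
    metricProj K x - x ∈ K ∧ ⟪metricProj K x - x, metricProj K x⟫ = 0 := by
  refine hK.complementarity (hK.metricProj_mem x) fun c hc => ?_
  have := (hK.metricProj_spec x).2 c hc
  rw [← neg_sub x, inner_neg_left]
  linarith

/-- Expresses `½‖Π x‖²` as the maximum of `⟪x, c⟫ - ½‖c‖²` over `c ∈ K`, attained at `c = Π x` by
`inner_metricProj`. Hence `Π x` is a subgradient. -/
theorem inner_sub_le_half_norm_metricProj_sq (hK : IsSelfDual K) (x c : E) (hc : c ∈ K) :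
    ⟪x, c⟫ - 1 / 2 * ‖c‖ ^ 2 ≤ 1 / 2 * ‖metricProj K x‖ ^ 2 := by
  have h1 := hK.inner_nonneg (hK.metricProj_moreau x).1 hc
  rw [inner_sub_left] at h1
  have h2 := sq_nonneg ‖metricProj K x - c‖
  rw [norm_sub_sq_real] at h2
  linarith

theorem inner_metricProj (hK : IsSelfDual K) (x : E) : ⟪x, metricProj K x⟫ = ‖metricProj K x‖ ^ 2 := by
  have h := (hK.metricProj_moreau x).2
  rw [inner_sub_left, real_inner_self_eq_norm_sq] at h
  linarith

theorem norm_metricProj_sub_le (hK : IsSelfDual K) (x y : E) : ‖metricProj K x - metricProj K y‖ ≤ ‖x - y‖ := by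
  set p := metricProj K x
  set q := metricProj K y
  have h1 := (hK.metricProj_spec x).2 q (hK.metricProj_mem y)
  have h2 := (hK.metricProj_spec y).2 p (hK.metricProj_mem x)
  have h3 : ‖p - q‖ ^ 2 ≤ ⟪x - y, p - q⟫ := by
    have : ⟪x - y, p - q⟫ - ‖p - q‖ ^ 2 = - ⟪x - p, q - p⟫ - ⟪y - q, p - q⟫ := by
      rw [← real_inner_self_eq_norm_sq, ← inner_sub_left, ← inner_neg_right, neg_sub,
        ← inner_sub_left]
      congr 1
      abel
    linarith
  have h4 := real_inner_le_norm (x - y) (p - q)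
  by_contra! h
  nlinarith [norm_nonneg (x - y)]

/-- Half the squared norm of the projection onto a self-dual cone is differentiable, and its
gradient is the projection. -/
theorem hasGradientAt_half_norm_metricProj_sq (hK : IsSelfDual K) (x : E) :
    HasGradientAt (fun x => 1 / 2 * ‖metricProj K x‖ ^ 2) (metricProj K x) x := by
  rw [hasGradientAt_iff_isLittleO]
  refine Asymptotics.IsBigO.trans_isLittleO
    (g := fun x' => ‖x' - x‖ ^ 2) ?_ ?_
  · refine Asymptotics.IsBigO.of_bound 1 (Eventually.of_forall fun x' => ?_)
    -- The subgradient inequalities at `x` and `x'` enclose the first-order remainder between `0`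
    -- and `⟪x' - x, Π x' - Π x⟫`, which is quadratic because `Π` is nonexpansive.
    have h1 := hK.inner_sub_le_half_norm_metricProj_sq x' (metricProj K x) (hK.metricProj_mem x)
    have h2 := hK.inner_sub_le_half_norm_metricProj_sq x (metricProj K x') (hK.metricProj_mem x')
    have e1 := hK.inner_metricProj x
    have e2 := hK.inner_metricProj x'
    have h3 : ⟪x' - x, metricProj K x' - metricProj K x⟫ ≤ ‖x' - x‖ ^ 2 := by
      refine (real_inner_le_norm _ _).trans ?_
      rw [sq]
      exact mul_le_mul_of_nonneg_left (hK.norm_metricProj_sub_le x' x) (norm_nonneg _)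
    rw [real_inner_comm (x' - x) (metricProj K x)]
    simp only [inner_sub_left, inner_sub_right] at h3 ⊢
    rw [Real.norm_eq_abs, Real.norm_of_nonneg (sq_nonneg _), one_mul, abs_le]
    constructor <;> nlinarith [sq_nonneg ‖x' - x‖]
  · have : (fun x' : E => ‖x' - x‖ ^ 2) = fun x' => ‖x' - x‖ * ‖x' - x‖ := by
      ext; ring
    rw [this]
    have h0 : (fun x' : E => ‖x' - x‖) =o[𝓝 x] fun _ => (1 : ℝ) := by
      rw [Asymptotics.isLittleO_one_iff]
      have : Tendsto (fun x' : E => ‖x' - x‖) (𝓝 x) (𝓝 ‖x - x‖) :=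
        (by fun_prop : Continuous fun x' : E => ‖x' - x‖).tendsto x
      simpa using this
    have h1 : (fun x' : E => ‖x' - x‖) =O[𝓝 x] fun x' => x' - x :=
      (Asymptotics.isBigO_refl _ _).norm_left
    simpa using (h0.mul_isBigO h1.norm_right).norm_right

theorem inner_sub_metricProj_le (hK : IsSelfDual K) (σ : ℝ) {x s s' c : E} (hs' : s' = metricProj K (s - σ • x))
    (hc : c ∈ K) : ⟪s - s', c - s'⟫ ≤ σ * ⟪x, c - s'⟫ := by
  have h := (hK.metricProj_spec (s - σ • x)).2 c hc
  rw [← hs', sub_right_comm, inner_sub_left, real_inner_smul_left] at h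
  linarith

theorem hasGradientAt_norm_metricProj_sub_smul_sq (hK : IsSelfDual K) {σ : ℝ} (hσ : σ ≠ 0) (s x : E) :
    HasGradientAt (fun x => 1 / (2 * σ) * ‖metricProj K (s - σ • x)‖ ^ 2)
      (-metricProj K (s - σ • x)) x := by
  have h1 := (hK.hasGradientAt_half_norm_metricProj_sq (s - σ • x)).hasFDerivAt
  have h2 : HasFDerivAt (fun x : E => s - σ • x) (-(σ • ContinuousLinearMap.id ℝ E)) x :=
    ((hasFDerivAt_id x).const_smul σ).const_sub s
  have h3 := (h1.comp x h2).const_mul σ⁻¹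
  rw [hasGradientAt_iff_hasFDerivAt]
  refine (h3.congr_fderiv ?_).congr_of_eventuallyEq (Eventually.of_forall fun x' => ?_)
  · ext v
    simp [hσ]
  · simp only [Function.comp_apply]
    field_simp

/-- The gradient of a quadratic function with the penalty terms of two conic constraints. -/
theorem hasGradientAt_quadratic_add_penalty (hK : IsSelfDual K) {L : Set E} (hL : IsSelfDual L) {σ : ℝ} (hσ : σ ≠ 0)
    (g s z x : E) :
    HasGradientAt (fun x => 1 / 2 * ‖x - g‖ ^ 2 + 1 / (2 * σ) *
      (‖metricProj K (s - σ • x)‖ ^ 2 + ‖metricProj L (z - σ • x)‖ ^ 2))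
      (x - g - metricProj K (s - σ • x) - metricProj L (z - σ • x)) x := by
  have h1 := (hK.hasGradientAt_norm_metricProj_sub_smul_sq hσ s x).hasFDerivAt
  have h2 := (hL.hasGradientAt_norm_metricProj_sub_smul_sq hσ z x).hasFDerivAt
  have h3 := (((hasFDerivAt_id x).sub_const g).norm_sq).const_mul (1 / 2 : ℝ)
  rw [hasGradientAt_iff_hasFDerivAt]
  refine (((h3.add h1).add h2).congr_fderiv ?_).congr_of_eventuallyEq
    (Eventually.of_forall fun x' => ?_)
  · ext v
    simp
    ring
  · simp only [Pi.add_apply, id]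
    ring

/-- The projection residual after a multiplier step is at most the length of the step divided by
the penalty parameter. -/
theorem norm_sub_metricProj_sub_le (hK : IsSelfDual K) {σ : ℝ} (hσ : 0 < σ) {x s s' : E}
    (hs' : s' = metricProj K (s - σ • x)) :
    ‖x - metricProj K (x - s')‖ ≤ ‖s' - s‖ / σ := by
  obtain ⟨hw, hws⟩ := hK.metricProj_moreau (s - σ • x)
  have hs'K := hK.metricProj_mem (s - σ • x)
  rw [← hs'] at hw hws hs'K
  set w := s' - (s - σ • x) with hwdef
  set p := metricProj K (x - s')
  -- The comparison point `u = σ⁻¹ w` lies in `K`, is orthogonal to `s'` by Moreau, and differs from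
  -- `x` by exactly `(s' - s)/σ` in norm. It remains to see that `p` is no farther from `x` than `u`
  -- is.
  have hu : σ⁻¹ • w ∈ K := hK.smul_mem (inv_nonneg.2 hσ.le) hw
  have hp : p ∈ K := hK.metricProj_mem _
  have h1 := (hK.metricProj_spec (x - s')).2 _ hu
  change ⟪x - s' - p, σ⁻¹ • w - p⟫ ≤ 0 at h1
  have h2 := hK.inner_nonneg hs'K hp
  have hxu : x - σ⁻¹ • w = - (σ⁻¹ • (s' - s)) := by
    rw [hwdef, show s' - (s - σ • x) = (s' - s) + σ • x by abel, smul_add, smul_smul,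
      inv_mul_cancel₀ hσ.ne', one_smul]
    abel
  have h3 : ⟪s', σ⁻¹ • w⟫ = 0 := by
    rw [real_inner_smul_right, real_inner_comm, hws, mul_zero]
  have h4 : ⟪x - p, σ⁻¹ • w - p⟫ ≤ 0 := by
    rw [show x - s' - p = (x - p) - s' by abel, inner_sub_left, inner_sub_right s', h3] at h1
    linarith
  have h5 : ‖x - p‖ ^ 2 ≤ ‖x - p‖ * ‖x - σ⁻¹ • w‖ := by
    calc ‖x - p‖ ^ 2 = ⟪x - p, x - σ⁻¹ • w⟫ + ⟪x - p, σ⁻¹ • w - p⟫ := by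
          rw [← inner_add_right, sub_add_sub_cancel, real_inner_self_eq_norm_sq]
      _ ≤ ⟪x - p, x - σ⁻¹ • w⟫ := by linarith
      _ ≤ _ := real_inner_le_norm _ _
  have h6 : ‖x - σ⁻¹ • w‖ = ‖s' - s‖ / σ := by
    rw [hxu, norm_neg, norm_smul, norm_inv, Real.norm_of_nonneg hσ.le]
    field_simp
  rw [← h6]
  by_contra! h
  nlinarith [norm_nonneg (x - σ⁻¹ • w)]

end IsSelfDual

end Cone

/-! ### Inexact proximal steps for a convex quadratic over a convex set. -/

section Prox

variable {E H : Type*} [NormedAddCommGroup E] [InnerProductSpace ℝ E]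
  [NormedAddCommGroup H] [InnerProductSpace ℝ H]

/-- The convex quadratic function `½‖B y + G‖² - ½‖G‖²`. -/
def quadObj (B : H →L[ℝ] E) (G : E) (y : H) : ℝ := 1 / 2 * ‖B y + G‖ ^ 2 - 1 / 2 * ‖G‖ ^ 2

/-- The minimizers of `quadObj B G` over `C`. -/
def quadSol (B : H →L[ℝ] E) (G : E) (C : Set H) : Set H :=
  {y | y ∈ C ∧ IsMinOn (quadObj B G) C y}

/-- `y'` is a proximal step from `y` for `quadObj B G` over `C` with parameter `σ`, up to the error
`e` in the gradient. -/
def IsProxStep (B : H →L[ℝ] E) (G : E) (C : Set H) (σ : ℝ) (y : H) (e : E) (y' : H) : Prop :=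
  y' ∈ C ∧ ∀ c ∈ C, ⟪y - y', c - y'⟫ ≤ σ * ⟪B y' + G + e, B (c - y')⟫

variable {B : H →L[ℝ] E} {G : E} {C : Set H}

theorem continuous_quadObj : Continuous (quadObj B G) := by
  unfold quadObj
  fun_prop

theorem quadObj_add (y h : H) :
    quadObj B G (y + h) = quadObj B G y + ⟪B y + G, B h⟫ + 1 / 2 * ‖B h‖ ^ 2 := by
  unfold quadObj
  rw [map_add, add_right_comm, norm_add_sq_real]
  ring

theorem nonneg_of_forall_quadratic_nonneg {a b : ℝ}
    (h : ∀ t : ℝ, 0 < t → t ≤ 1 → 0 ≤ t * a + t ^ 2 * b) : 0 ≤ a := by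
  have h1 : ∀ t : ℝ, 0 < t → t ≤ 1 → 0 ≤ a + t * b := fun t ht ht1 => by
    have := h t ht ht1
    rw [show t * a + t ^ 2 * b = t * (a + t * b) by ring] at this
    exact nonneg_of_mul_nonneg_right this ht
  have h2 : Tendsto (fun t : ℝ => a + t * b) (𝓝[>] 0) (𝓝 (a + 0 * b)) :=
    ((by fun_prop : Continuous fun t : ℝ => a + t * b).tendsto 0).mono_left nhdsWithin_le_nhds
  rw [zero_mul, add_zero] at h2
  refine ge_of_tendsto h2 ?_
  filter_upwards [Ioc_mem_nhdsGT (zero_lt_one' ℝ)] with t ht using h1 t ht.1 ht.2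

theorem inner_nonneg_of_mem_quadSol (hC : Convex ℝ C) {z : H} (hz : z ∈ quadSol B G C) {c : H}
    (hc : c ∈ C) : 0 ≤ ⟪B z + G, B (c - z)⟫ := by
  refine nonneg_of_forall_quadratic_nonneg (b := 1 / 2 * ‖B (c - z)‖ ^ 2) fun t ht ht1 => ?_
  have hm : z + t • (c - z) ∈ C := hC.add_smul_sub_mem hz.1 hc ⟨ht.le, ht1⟩
  have h : quadObj B G z ≤ quadObj B G (z + t • (c - z)) := hz.2 hm
  rw [quadObj_add, map_smul, real_inner_smul_right, norm_smul, mul_pow, Real.norm_eq_abs,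
    sq_abs] at h
  linarith

theorem isClosed_quadSol (hC : IsClosed C) : IsClosed (quadSol B G C) := by
  have h : quadSol B G C = C ∩ ⋂ c ∈ C, {y | quadObj B G y ≤ quadObj B G c} := by
    ext y
    simp [quadSol, isMinOn_iff]
  rw [h]
  exact hC.inter (isClosed_biInter fun c _ => isClosed_le continuous_quadObj continuous_const)

theorem quadObj_eq_of_mem_quadSol {z z' : H} (hz : z ∈ quadSol B G C) (hz' : z' ∈ quadSol B G C) :
    quadObj B G z = quadObj B G z' :=
  le_antisymm (hz.2 hz'.1) (hz'.2 hz.1)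

/-- The second-order term `½‖B(z - y')‖²` in the exact expansion of the quadratic pays for `⟪e, B(z
- y')⟫` by Young's inequality, leaving only `½‖e‖²`. -/
theorem IsProxStep.inner_ge {σ : ℝ} (hσ : 0 < σ) {y y' z : H} {e : E}
    (h : IsProxStep B G C σ y e y') (hz : z ∈ C) :
    σ * (quadObj B G y' - quadObj B G z) - σ / 2 * ‖e‖ ^ 2 ≤ ⟪y - y', y' - z⟫ := by
  have h1 := h.2 z hz
  have h2 := quadObj_add (B := B) (G := G) y' (z - y')
  rw [add_sub_cancel] at h2
  have h3 : ⟪e, B (z - y')⟫ ≤ 1 / 2 * ‖e‖ ^ 2 + 1 / 2 * ‖B (z - y')‖ ^ 2 := by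
    have := norm_sub_sq_real e (B (z - y'))
    nlinarith [sq_nonneg ‖e - B (z - y')‖]
  rw [inner_add_left] at h1
  rw [← neg_sub z y', inner_neg_right]
  nlinarith

theorem IsProxStep.norm_sq_add_norm_sq_le {σ : ℝ} (hσ : 0 < σ) {y y' z : H} {e : E}
    (h : IsProxStep B G C σ y e y') (hz : z ∈ quadSol B G C) :
    ‖y' - z‖ ^ 2 + ‖y' - y‖ ^ 2 + 2 * σ * (quadObj B G y' - quadObj B G z) ≤
      ‖y - z‖ ^ 2 + σ * ‖e‖ ^ 2 := by
  have h1 := h.inner_ge hσ hz.1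
  have h2 : ‖y - z‖ ^ 2 = ‖y' - y‖ ^ 2 + 2 * ⟪y - y', y' - z⟫ + ‖y' - z‖ ^ 2 := by
    rw [norm_sub_rev y', ← norm_add_sq_real, sub_add_sub_cancel]
  linarith

/-- Each step is tested at the other. In the sum the monotone part `-‖B(y' - w)‖²` absorbs the error
term. -/
theorem IsProxStep.norm_sub_sq_le {σ : ℝ} (hσ : 0 < σ) {y y' w : H} {e : E}
    (h : IsProxStep B G C σ y e y') (hw : IsProxStep B G C σ y 0 w) :
    ‖y' - w‖ ^ 2 ≤ σ * ‖e‖ ^ 2 := by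
  have h1 := h.2 w hw.1
  have h2 := hw.2 y' h.1
  have h3 : ‖y' - w‖ ^ 2 = ⟪y - y', w - y'⟫ + ⟪y - w, y' - w⟫ := by
    rw [← neg_sub y' w, inner_neg_right, ← sub_eq_neg_add, ← inner_sub_left,
      sub_sub_sub_cancel_left, real_inner_self_eq_norm_sq]
  have h4 : ⟪B y' + G + e, B (w - y')⟫ + ⟪B w + G + 0, B (y' - w)⟫ =
      - ‖B (y' - w)‖ ^ 2 - ⟪e, B (y' - w)⟫ := by
    rw [← neg_sub y' w, map_neg, inner_neg_right, ← real_inner_self_eq_norm_sq,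
      ← sub_eq_neg_add, ← inner_sub_left, ← inner_neg_left, ← inner_sub_left, map_sub]
    congr 1
    abel
  have h5 := norm_add_sq_real e (B (y' - w))
  nlinarith [sq_nonneg ‖e + B (y' - w)‖, sq_nonneg ‖e‖, sq_nonneg ‖B (y' - w)‖]

theorem exists_isProxStep [FiniteDimensional ℝ H] (hC : Convex ℝ C) (hcl : IsClosed C)
    (hne : C.Nonempty) {σ : ℝ} (hσ : 0 < σ) (y : H) : ∃ w, IsProxStep B G C σ y 0 w := by
  obtain ⟨c₀, hc₀⟩ := hne
  let f : H → ℝ := fun w => σ * (1 / 2 * ‖B w + G‖ ^ 2) + 1 / 2 * ‖w - y‖ ^ 2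
  have hf : Continuous f := by fun_prop
  have hcoe : Tendsto f (cocompact H) atTop := by
    refine tendsto_atTop_mono (f := fun w => 1 / 2 * ‖w - y‖ ^ 2) (fun w => ?_) ?_
    · exact le_add_of_nonneg_left (by positivity)
    · refine Tendsto.const_mul_atTop (by norm_num) ?_
      refine (tendsto_pow_atTop two_ne_zero).comp ?_
      simpa [dist_eq_norm] using tendsto_dist_right_cocompact_atTop y
  obtain ⟨w, hw, hmin⟩ := hf.continuousOn.exists_isMinOn' hcl hc₀
    ((hcoe.eventually_ge_atTop (f c₀)).filter_mono inf_le_left)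
  refine ⟨w, hw, fun c hc => ?_⟩
  rw [add_zero, ← sub_nonneg]
  refine nonneg_of_forall_quadratic_nonneg
    (b := σ / 2 * ‖B (c - w)‖ ^ 2 + 1 / 2 * ‖c - w‖ ^ 2) fun t ht ht1 => ?_
  have hm : w + t • (c - w) ∈ C := hC.add_smul_sub_mem hw hc ⟨ht.le, ht1⟩
  have h : f w ≤ f (w + t • (c - w)) := hmin hm
  simp only [f] at h
  rw [map_add, map_smul, add_right_comm, norm_add_sq_real (B w + G), add_sub_right_comm,
    norm_add_sq_real (w - y), real_inner_smul_right, real_inner_smul_right, norm_smul, norm_smul,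
    mul_pow, mul_pow, Real.norm_eq_abs, sq_abs, ← neg_sub y w, inner_neg_left] at h
  linarith

/-- Subtracting the partial sums of `b` makes `a` antitone and bounded below. -/
theorem exists_tendsto_of_quasi_antitone {a b : ℕ → ℝ} (ha : ∀ k, 0 ≤ a k) (hb : Summable b)
    (h : ∀ k, a (k + 1) ≤ a k + b k) : ∃ l, Tendsto a atTop (𝓝 l) := by
  let g : ℕ → ℝ := fun k => a k - ∑ i ∈ Finset.range k, b i
  have hs := hb.hasSum.tendsto_sum_nat
  have hg : Antitone g := antitone_nat_of_succ_le fun k => by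
    simp only [g, Finset.sum_range_succ]
    linarith [h k]
  obtain ⟨M, hM⟩ := hs.bddAbove_range
  have hbd : BddBelow (Set.range g) := by
    refine ⟨-M, ?_⟩
    rintro _ ⟨k, rfl⟩
    have := hM ⟨k, rfl⟩
    simp only [g]
    linarith [ha k]
  have := (tendsto_atTop_ciInf hg hbd).add hs
  exact ⟨_, this.congr fun k => by simp [g]⟩

/-- Convergence of the inexact proximal point method with summable errors. -/
theorem exists_tendsto_of_isProxStep [FiniteDimensional ℝ H] (hcl : IsClosed C)
    (hne : (quadSol B G C).Nonempty) {σ : ℕ → ℝ} {σ₀ : ℝ} (hσ₀ : 0 < σ₀) (hσ : ∀ k, σ₀ ≤ σ k)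
    {y : ℕ → H} {e : ℕ → E} (hstep : ∀ k, IsProxStep B G C (σ k) (y k) (e k) (y (k + 1)))
    (hsum : Summable fun k => σ k * ‖e k‖ ^ 2) :
    ∃ z ∈ quadSol B G C, Tendsto y atTop (𝓝 z) := by
  have hpos : ∀ k, 0 < σ k := fun k => hσ₀.trans_le (hσ k)
  have hconv : ∀ z ∈ quadSol B G C, ∃ l, Tendsto (fun k => ‖y k - z‖ ^ 2) atTop (𝓝 l) := by
    intro z hz
    refine exists_tendsto_of_quasi_antitone (fun k => sq_nonneg _) hsum fun k => ?_
    have h1 := (hstep k).norm_sq_add_norm_sq_le (hpos k) hz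
    have h2 : quadObj B G z ≤ quadObj B G (y (k + 1)) := hz.2 (hstep k).1
    have h3 := mul_nonneg (hpos k).le (sub_nonneg.2 h2)
    nlinarith [sq_nonneg ‖y (k + 1) - y k‖]
  obtain ⟨z, hz⟩ := hne
  obtain ⟨l, hl⟩ := hconv z hz
  -- Since the distances to `z` converge, their successive differences vanish. With `σ k ≥ σ₀`,
  -- these bound the objective gap. The index is shifted because `y 0` need not lie in `C`.
  have hobj : Tendsto (fun k => quadObj B G (y (k + 1))) atTop (𝓝 (quadObj B G z)) := by
    have hb : Tendsto (fun k => quadObj B G z + (‖y k - z‖ ^ 2 - ‖y (k + 1) - z‖ ^ 2 +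
        σ k * ‖e k‖ ^ 2) / (2 * σ₀)) atTop (𝓝 (quadObj B G z + (l - l + 0) / (2 * σ₀))) :=
      (((hl.sub ((tendsto_add_atTop_iff_nat 1).2 hl)).add
        hsum.tendsto_atTop_zero).div_const _).const_add _
    rw [sub_self, add_zero, zero_div, add_zero] at hb
    refine tendsto_of_tendsto_of_tendsto_of_le_of_le tendsto_const_nhds hb
      (fun k => hz.2 (hstep k).1) fun k => ?_
    have h1 := (hstep k).norm_sq_add_norm_sq_le (hpos k) hz
    have h2 : quadObj B G z ≤ quadObj B G (y (k + 1)) := hz.2 (hstep k).1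
    have h3 := mul_le_mul_of_nonneg_right (hσ k) (sub_nonneg.2 h2)
    rw [← sub_le_iff_le_add', le_div_iff₀ (by positivity)]
    nlinarith [sq_nonneg ‖y (k + 1) - y k‖]
  have hbdd : Bornology.IsBounded (Set.range fun k => y (k + 1)) := by
    obtain ⟨M, hM⟩ := hl.bddAbove_range
    refine (Metric.isBounded_closedBall (x := z) (r := √M)).subset ?_
    rintro _ ⟨k, rfl⟩
    rw [Metric.mem_closedBall, dist_eq_norm]
    exact Real.le_sqrt_of_sq_le (hM ⟨k + 1, rfl⟩)
  obtain ⟨w, -, ψ, hψ, hw⟩ := tendsto_subseq_of_bounded hbdd fun k => ⟨k, rfl⟩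
  have hwC : w ∈ C := hcl.mem_of_tendsto hw (Eventually.of_forall fun k => (hstep _).1)
  have hwobj : quadObj B G w = quadObj B G z :=
    tendsto_nhds_unique ((continuous_quadObj.tendsto w).comp hw) (hobj.comp hψ.tendsto_atTop)
  have hwsol : w ∈ quadSol B G C := ⟨hwC, fun c hc => by
    simpa only [Set.mem_ofPred_eq, hwobj] using hz.2 hc⟩
  refine ⟨w, hwsol, ?_⟩
  -- The distances to the cluster point `w` converge, and tend to `0` along a subsequence, hence
  -- along the whole sequence.
  obtain ⟨m, hm⟩ := hconv w hwsol
  have h1 : Tendsto (fun k => ‖y (ψ k + 1) - w‖ ^ 2) atTop (𝓝 m) :=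
    hm.comp ((tendsto_add_atTop_nat 1).comp hψ.tendsto_atTop)
  have h2 : Tendsto (fun k => ‖y (ψ k + 1) - w‖ ^ 2) atTop (𝓝 0) := by
    have := ((tendsto_iff_norm_sub_tendsto_zero).1 hw).pow 2
    simpa using this
  rw [tendsto_nhds_unique h1 h2] at hm
  rw [tendsto_iff_norm_sub_tendsto_zero]
  have := hm.sqrt
  simpa [Real.sqrt_sq] using this

/-- The contraction of the distance to the solution set under an exact proximal step, where
quadratic growth holds. -/
theorem IsProxStep.infDist_le [FiniteDimensional ℝ H] (hcl : IsClosed C) {σ κ : ℝ} (hσ : 0 < σ)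
    (hκ : 0 < κ) {y w z : H} (h : IsProxStep B G C σ y 0 w) (hz : z ∈ quadSol B G C)
    (hgrowth : quadObj B G z + κ * Metric.infDist w (quadSol B G C) ^ 2 ≤ quadObj B G w) :
    ‖w - y‖ ≤ Metric.infDist y (quadSol B G C) ∧
    Metric.infDist w (quadSol B G C) ≤
      1 / √(1 + σ ^ 2 * κ ^ 2) * Metric.infDist y (quadSol B G C) := by
  have hΩ := isClosed_quadSol (B := B) (G := G) hcl
  -- Two solutions are used: `u`, nearest to `y`, yields `‖w - y‖² + d'² ≤ d²`; `v`, nearest to `w`,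
  -- combines with growth and Cauchy–Schwarz to give `σκd' ≤ ‖w - y‖`. Together these give the
  -- contraction.
  obtain ⟨u, hu, hyu⟩ := hΩ.exists_infDist_eq_dist ⟨z, hz⟩ y
  obtain ⟨v, hv, hwv⟩ := hΩ.exists_infDist_eq_dist ⟨z, hz⟩ w
  have hd : Metric.infDist w (quadSol B G C) ≤ ‖w - u‖ := by
    rw [← dist_eq_norm]
    exact Metric.infDist_le_dist_of_mem hu
  set d := Metric.infDist y (quadSol B G C)
  set d' := Metric.infDist w (quadSol B G C)
  have hd0 : 0 ≤ d := Metric.infDist_nonneg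
  have hd0' : 0 ≤ d' := Metric.infDist_nonneg
  have h1 := h.norm_sq_add_norm_sq_le hσ hu
  have h2 := h.inner_ge hσ hv.1
  rw [quadObj_eq_of_mem_quadSol hu hz, norm_zero] at h1
  rw [quadObj_eq_of_mem_quadSol hv hz, norm_zero] at h2
  rw [dist_eq_norm] at hyu hwv
  have h3 := real_inner_le_norm (y - w) (w - v)
  rw [← hwv, norm_sub_rev y w] at h3
  rw [← hyu] at h1
  have h4 : 0 ≤ 2 * σ * (quadObj B G w - quadObj B G z) := by
    have : 0 ≤ κ * d' ^ 2 := by positivity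
    exact mul_nonneg (by positivity) (by linarith)
  have h5 : ‖w - y‖ ^ 2 + d' ^ 2 ≤ d ^ 2 := by
    have := pow_le_pow_left₀ hd0' hd 2
    linarith
  have h6 : σ * κ * d' ≤ ‖w - y‖ := by
    rcases hd0'.eq_or_lt with h0 | h0
    · rw [← h0, mul_zero]
      exact norm_nonneg _
    · refine le_of_mul_le_mul_right ?_ h0
      have := mul_le_mul_of_nonneg_left (sub_le_sub_right hgrowth (quadObj B G z)) hσ.le
      rw [add_sub_cancel_left] at this
      linarith
  refine ⟨abs_le_of_sq_le_sq' (by nlinarith [sq_nonneg d']) hd0 |>.2, ?_⟩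
  rw [one_div, inv_mul_eq_div, le_div_iff₀ (by positivity)]
  refine abs_le_of_sq_le_sq' ?_ hd0 |>.2
  rw [mul_pow, Real.sq_sqrt (by positivity)]
  have := pow_le_pow_left₀ (by positivity) h6 2
  linarith [mul_pow (σ * κ) d' 2, mul_pow σ κ 2]

/-- The rate of an inexact proximal step with relative error `η`. -/
theorem IsProxStep.infDist_le_mu [FiniteDimensional ℝ H] (hC : Convex ℝ C) (hcl : IsClosed C)
    {σ κ η r : ℝ} (hσ : 0 < σ) (hκ : 0 < κ) (hη : 0 < η) (hη1 : η < 1) {y y' z : H} {e : E}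
    (h : IsProxStep B G C σ y e y') (hz : z ∈ quadSol B G C)
    (hgrowth : ∀ w ∈ Metric.closedBall z r ∩ C,
      quadObj B G z + κ * Metric.infDist w (quadSol B G C) ^ 2 ≤ quadObj B G w)
    (hr : √σ * ‖e‖ + ‖y' - z‖ ≤ r) (he : √σ * ‖e‖ ≤ η * ‖y' - y‖) :
    (1 - η) * ‖y' - y‖ ≤ Metric.infDist y (quadSol B G C) ∧
    Metric.infDist y' (quadSol B G C) ≤ mu κ η σ * Metric.infDist y (quadSol B G C) := by
  obtain ⟨w, hw⟩ := exists_isProxStep (B := B) (G := G) hC hcl ⟨z, hz.1⟩ hσ y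
  have hy'w : ‖y' - w‖ ≤ √σ * ‖e‖ := by
    refine abs_le_of_sq_le_sq' ?_ (by positivity) |>.2
    rw [mul_pow, Real.sq_sqrt hσ.le]
    exact h.norm_sub_sq_le hσ hw
  -- Growth is only local and is applied at the exact step `w`, not at `y'`; this is why `hr`
  -- includes the error `√σ‖e‖`.
  have hwz : w ∈ Metric.closedBall z r := by
    rw [Metric.mem_closedBall, dist_eq_norm]
    have := norm_sub_le_norm_sub_add_norm_sub w y' z
    rw [norm_sub_rev w y'] at this
    linarith
  obtain ⟨h1, h2⟩ := hw.infDist_le hcl hσ hκ hz (hgrowth w ⟨hwz, hw.1⟩)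
  set d := Metric.infDist y (quadSol B G C)
  have h3 := norm_sub_le_norm_sub_add_norm_sub y' w y
  have h4 : (1 - η) * ‖y' - y‖ ≤ d := by linarith
  refine ⟨h4, ?_⟩
  have h5 : Metric.infDist y' (quadSol B G C) ≤ Metric.infDist w (quadSol B G C) + ‖y' - w‖ := by
    rw [← dist_eq_norm]
    exact Metric.infDist_le_infDist_add_dist
  have hd0 : 0 ≤ d := Metric.infDist_nonneg
  have hη1' : 0 < 1 - η := by linarith
  unfold mu
  rw [div_mul_eq_mul_div, le_div_iff₀ hη1', mul_comm _ (1 - η)]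
  set q := 1 / √(1 + σ ^ 2 * κ ^ 2) with hq
  have hq0 : 0 ≤ q := by positivity
  have hqd : 0 ≤ q * d := mul_nonneg hq0 hd0
  have h6 : Metric.infDist y' (quadSol B G C) ≤ q * d + η * ‖y' - y‖ := by linarith
  calc (1 - η) * Metric.infDist y' (quadSol B G C)
      ≤ (1 - η) * (q * d + η * ‖y' - y‖) := mul_le_mul_of_nonneg_left h6 hη1'.le
    _ = (1 - η) * (q * d) + η * ((1 - η) * ‖y' - y‖) := by ring
    _ ≤ (1 + η) * (q * d) + η * d :=
        add_le_add (mul_le_mul_of_nonneg_right (by linarith) hqd)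
          (mul_le_mul_of_nonneg_left h4 hη.le)
    _ = (η + (η + 1) / √(1 + σ ^ 2 * κ ^ 2)) * d := by rw [hq]; ring

/-- A convex quadratic function whose linear part is injective along a closed cone attains its
minimum over the cone. -/
theorem quadSol_nonempty [FiniteDimensional ℝ H] (hC : IsSelfDual C)
    (hB : ∀ y ∈ C, B y = 0 → y = 0) : (quadSol B G C).Nonempty := by
  -- By compactness of the unit sphere within the cone, `B` is bounded below there, so the objective
  -- exceeds its value at `0` outside a ball.
  obtain ⟨c, hc, hcB⟩ : ∃ c > 0, ∀ y ∈ C, c * ‖y‖ ≤ ‖B y‖ := by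
    have hcomp : IsCompact (Metric.sphere (0 : H) 1 ∩ C) :=
      (isCompact_sphere _ _).inter_right hC.isClosed
    rcases (Metric.sphere (0 : H) 1 ∩ C).eq_empty_or_nonempty with hemp | hne
    · refine ⟨1, one_pos, fun y hy => ?_⟩
      by_cases hy0 : y = 0
      · simp [hy0]
      · have : ‖y‖⁻¹ • y ∈ Metric.sphere (0 : H) 1 ∩ C :=
          ⟨by simp [norm_smul, hy0], hC.smul_mem (by positivity) hy⟩
        simp [hemp] at this
    · obtain ⟨u, hu, hmin⟩ := hcomp.exists_isMinOn hne
        (f := fun y => ‖B y‖) (by fun_prop)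
      refine ⟨‖B u‖, norm_pos_iff.2 fun h0 => ?_, fun y hy => ?_⟩
      · have := hu.1
        simp [hB u hu.2 h0] at this
      · by_cases hy0 : y = 0
        · simp [hy0]
        · have hmem : ‖y‖⁻¹ • y ∈ Metric.sphere (0 : H) 1 ∩ C :=
            ⟨by simp [norm_smul, hy0], hC.smul_mem (by positivity) hy⟩
          have h : ‖B u‖ ≤ ‖B (‖y‖⁻¹ • y)‖ := hmin hmem
          rw [map_smul, norm_smul, norm_inv, norm_norm, inv_mul_eq_div,
            le_div_iff₀ (norm_pos_iff.2 hy0)] at h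
          exact h
  let R := (2 * ‖G‖) / c
  have hball : ∀ y ∈ C, y ∉ Metric.closedBall (0 : H) R → quadObj B G 0 ≤ quadObj B G y := by
    intro y hy hyR
    rw [mem_closedBall_zero_iff, not_le, div_lt_iff₀ hc] at hyR
    have h1 := hcB y hy
    have h2 : ‖B y‖ ≤ ‖B y + G‖ + ‖G‖ := by simpa using norm_sub_le (B y + G) G
    have h3 : ‖G‖ ≤ ‖B y + G‖ := by linarith
    have h4 := pow_le_pow_left₀ (norm_nonneg _) h3 2
    simp only [quadObj, map_zero, zero_add]
    linarith
  obtain ⟨z, hz, hmin⟩ := (continuous_quadObj (B := B) (G := G)).continuousOn.exists_isMinOn'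
    hC.isClosed hC.zero_mem (by
      rw [eventually_inf_principal]
      filter_upwards [(isCompact_closedBall (0 : H) R).compl_mem_cocompact] with y hy hyC
      exact hball y hyC hy)
  exact ⟨z, hz, hmin⟩

end Prox

/-! ### The matrix cones, the dual problem and the multiplier update. -/

section Matrices

variable {n : ℕ}

theorem inner_eq_sum (X Y : SymMat n) :
    ⟪X, Y⟫ = ∑ i, ∑ j, X.toMatrix i j * Y.toMatrix i j := by
  rw [Submodule.coe_inner, PiLp.inner_apply, Fintype.sum_prod_type]
  simp [SymMat.toMatrix, mul_comm]

theorem toMatrix_symm (X : SymMat n) (i j : Fin n) : X.toMatrix i j = X.toMatrix j i :=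
  X.2 i j

theorem posSemidef_toMatrix_iff (X : SymMat n) :
    X.toMatrix.PosSemidef ↔ ∀ v : Fin n → ℝ, 0 ≤ ∑ i, ∑ j, X.toMatrix i j * (v i * v j) := by
  have hH : X.toMatrix.IsHermitian := by
    ext i j
    simpa using toMatrix_symm X j i
  have hq : ∀ v : Fin n → ℝ, star v ⬝ᵥ (X.toMatrix.mulVec v) =
      ∑ i, ∑ j, X.toMatrix i j * (v i * v j) := by
    intro v
    simp only [dotProduct, Matrix.mulVec, Finset.mul_sum, Pi.star_apply, star_trivial]
    exact Finset.sum_congr rfl fun i _ => Finset.sum_congr rfl fun j _ => by ring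
  rw [Matrix.posSemidef_iff_dotProduct_mulVec]
  simp only [hq, hH, true_and]

/-- The symmetric matrix with the entries `a i j + a j i`. -/
def symOf (a : Fin n → Fin n → ℝ) : SymMat n :=
  ⟨WithLp.toLp 2 fun p => a p.1 p.2 + a p.2 p.1, fun i j => by simp [add_comm]⟩

theorem toMatrix_symOf (a : Fin n → Fin n → ℝ) (i j : Fin n) :
    (symOf a).toMatrix i j = a i j + a j i := rfl

theorem inner_symOf (X : SymMat n) (a : Fin n → Fin n → ℝ) :
    ⟪X, symOf a⟫ = 2 * ∑ i, ∑ j, X.toMatrix i j * a i j := by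
  simp only [inner_eq_sum, toMatrix_symOf, mul_add, Finset.sum_add_distrib]
  rw [two_mul, add_right_inj, Finset.sum_comm]
  exact Finset.sum_congr rfl fun i _ => Finset.sum_congr rfl fun j _ => by rw [toMatrix_symm]

-- Factoring `X = MᵀM` writes `⟪X, Y⟫` as a sum of quadratic forms of `Y` at the rows of `M`.
-- Conversely, pairing with `2vvᵀ` recovers the quadratic form of `X`.
open scoped MatrixOrder Matrix.Norms.L2Operator in
theorem isSelfDual_psdCone : IsSelfDual (psdCone n) := by
  intro X
  constructor
  · intro hX Y hY
    obtain ⟨M, hM⟩ := (CStarAlgebra.nonneg_iff_eq_star_mul_self (a := X.toMatrix)).1 hX.nonneg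
    have hY' := (posSemidef_toMatrix_iff Y).1 hY
    have hXe : ∀ i j, X.toMatrix i j = ∑ k, M k i * M k j := by
      intro i j
      rw [hM]
      simp [Matrix.mul_apply, Matrix.star_apply]
    have h : ⟪X, Y⟫ = ∑ k, ∑ i, ∑ j, Y.toMatrix i j * (M k i * M k j) := by
      rw [inner_eq_sum, Finset.sum_comm]
      simp only [hXe, Finset.sum_mul]
      rw [Finset.sum_comm, Finset.sum_comm_cycle]
      exact Finset.sum_congr rfl fun k _ => Finset.sum_congr rfl fun i _ =>
        Finset.sum_congr rfl fun j _ => mul_comm _ _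
    rw [h]
    exact Finset.sum_nonneg fun k _ => hY' fun i => M k i
  · intro h
    refine (posSemidef_toMatrix_iff X).2 fun v => ?_
    have hmem : symOf (fun i j => v i * v j) ∈ psdCone n := by
      refine (posSemidef_toMatrix_iff _).2 fun u => ?_
      have : ∑ i, ∑ j, (symOf fun i j => v i * v j).toMatrix i j * (u i * u j) =
          2 * (∑ i, v i * u i) ^ 2 := by
        rw [sq, Finset.sum_mul_sum, Finset.mul_sum]
        refine Finset.sum_congr rfl fun i _ => ?_
        rw [Finset.mul_sum]
        refine Finset.sum_congr rfl fun j _ => ?_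
        rw [toMatrix_symOf]
        ring
      rw [this]
      positivity
    have := h _ hmem
    rw [inner_symOf] at this
    linarith

theorem isSelfDual_nonnegCone : IsSelfDual (nonnegCone n) := by
  intro X
  constructor
  · intro hX Y hY
    rw [inner_eq_sum]
    exact Finset.sum_nonneg fun i _ => Finset.sum_nonneg fun j _ => mul_nonneg (hX i j) (hY i j)
  · intro h k l
    -- The symmetrized matrix unit isolates the entry `(k, l)`.
    let a : Fin n → Fin n → ℝ := fun i j => if i = k then (if j = l then 1 else 0) else 0
    have ha : ∀ i j, 0 ≤ a i j := fun i j => by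
      simp only [a]
      split_ifs <;> simp
    have := h (symOf a) fun i j => add_nonneg (ha i j) (ha j i)
    rw [inner_symOf] at this
    simp [a] at this
    exact this

theorem isSelfDual_dualFeasible : IsSelfDual (dualFeasible n) := by
  have h1 := isSelfDual_psdCone (n := n)
  have h2 := isSelfDual_nonnegCone (n := n)
  intro x
  constructor
  · intro hx y hy
    rw [WithLp.prod_inner_apply]
    exact add_nonneg (h1.inner_nonneg hx.1 hy.1) (h2.inner_nonneg hx.2 hy.2)
  · intro h
    refine ⟨(h1 _).2 fun s hs => ?_, (h2 _).2 fun z hz => ?_⟩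
    · have := h (pair s 0) ⟨hs, h2.zero_mem⟩
      rw [WithLp.prod_inner_apply] at this
      simpa [pair] using this
    · have := h (pair 0 z) ⟨h1.zero_mem, hz⟩
      rw [WithLp.prod_inner_apply] at this
      simpa [pair] using this

/-- The continuous linear map `(S, Z) ↦ S + Z`. -/
def sumMap (n : ℕ) : SymPair n →L[ℝ] SymMat n :=
  LinearMap.toContinuousLinearMap
    { toFun := fun y => y.fst + y.snd
      map_add' := fun x y => by
        simp only [WithLp.add_fst, WithLp.add_snd]
        abel
      map_smul' := fun c x => by simp }

theorem sumMap_apply (y : SymPair n) : sumMap n y = y.fst + y.snd := rfl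

theorem quadSol_sumMap (G : SymMat n) : quadSol (sumMap n) G (dualFeasible n) = solD G := rfl

/-- If `S = -Z`, the entries of `S` are nonpositive, while their sum `1ᵀS1` is nonnegative, so all
vanish. This yields existence of dual solutions. -/
theorem eq_zero_of_mem_dualFeasible {y : SymPair n} (hy : y ∈ dualFeasible n)
    (h0 : sumMap n y = 0) : y = 0 := by
  rw [sumMap_apply] at h0
  have hZ : y.snd = - y.fst := eq_neg_of_add_eq_zero_right h0
  have hneg : ∀ i j, y.fst.toMatrix i j ≤ 0 := fun i j => by
    have := hy.2 i j
    rw [hZ] at this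
    have h' : (-y.fst).toMatrix i j = - y.fst.toMatrix i j := rfl
    rw [h'] at this
    linarith
  have hsum := (posSemidef_toMatrix_iff _).1 hy.1 fun _ => 1
  simp only [mul_one] at hsum
  have hrow : ∀ i ∈ Finset.univ, ∑ j, y.fst.toMatrix i j ≤ 0 := fun i _ =>
    Finset.sum_nonpos fun j _ => hneg i j
  have hrow0 := (Finset.sum_eq_zero_iff_of_nonpos hrow).1 (le_antisymm
    (Finset.sum_nonpos hrow) hsum)
  have hfst : y.fst = 0 := by
    ext ⟨i, j⟩
    exact (Finset.sum_eq_zero_iff_of_nonpos fun j _ => hneg i j).1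
      (hrow0 i (Finset.mem_univ i)) j (Finset.mem_univ j)
  have hsnd : y.snd = 0 := by rw [hZ, hfst, neg_zero]
  rw [← norm_eq_zero, ← sq_eq_zero_iff, WithLp.prod_norm_sq_eq_of_L2, hfst, hsnd]
  simp

theorem solD_nonempty (G : SymMat n) : (solD G).Nonempty :=
  quadSol_nonempty (B := sumMap n) isSelfDual_dualFeasible fun _ => eq_zero_of_mem_dualFeasible

theorem gradient_augLag (G : SymMat n) {σ : ℝ} (hσ : σ ≠ 0) (S Z X : SymMat n) :
    gradient (augLag G σ S Z) X =
      X - G - metricProj (psdCone n) (S - σ • X) - metricProj (nonnegCone n) (Z - σ • X) :=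
  (isSelfDual_psdCone.hasGradientAt_quadratic_add_penalty isSelfDual_nonnegCone hσ G S Z X).gradient

/-- A dual solution yields the primal solution. -/
theorem solP_eq_singleton (G : SymMat n) {y : SymPair n} (hy : y ∈ solD G) :
    solP G = {sumMap n y + G} := by
  have hC := isSelfDual_dualFeasible (n := n)
  set X := sumMap n y + G with hX
  have hin : ∀ c : SymPair n, ⟪X, sumMap n c⟫ = ⟪pair X X, c⟫ := fun c => by
    rw [WithLp.prod_inner_apply, sumMap_apply, inner_add_right]
    rfl
  -- The dual gradient at `y` is `(X, X)`, so complementarity gives at once that `X` is doubly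
  -- nonnegative and that `⟪X, S + Z⟫ = 0`.
  obtain ⟨hmem, h0⟩ := hC.complementarity (w := pair X X) hy.1 fun c hc => by
    rw [← hin]
    exact inner_nonneg_of_mem_quadSol (B := sumMap n) hC.convex hy hc
  have hkey : ∀ Y ∈ dnnCone n, 1 / 2 * ‖X - G‖ ^ 2 + 1 / 2 * ‖Y - X‖ ^ 2 ≤ 1 / 2 * ‖Y - G‖ ^ 2 := by
    intro Y hY
    have h1 : 0 ≤ ⟪pair Y Y, y⟫ := hC.inner_nonneg (x := pair Y Y) hY hy.1
    have h2 : ⟪X - G, Y - X⟫ = ⟪pair Y Y, y⟫ - ⟪pair X X, y⟫ := by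
      rw [hX, add_sub_cancel_right, ← hX, real_inner_comm, inner_sub_left, hin,
        WithLp.prod_inner_apply (pair Y Y), sumMap_apply, inner_add_right]
      rfl
    have h3 := norm_add_sq_real (X - G) (Y - X)
    rw [add_comm (X - G), sub_add_sub_cancel] at h3
    linarith
  ext Y
  simp only [Set.mem_singleton_iff]
  constructor
  · rintro ⟨hY, hmin⟩
    have h1 : (1 / 2 : ℝ) * ‖Y - G‖ ^ 2 ≤ 1 / 2 * ‖X - G‖ ^ 2 := hmin (a := X) hmem
    have h2 := hkey Y hY
    have h3 : ‖Y - X‖ ^ 2 = 0 := le_antisymm (by linarith) (sq_nonneg _)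
    rwa [sq_eq_zero_iff, norm_eq_zero, sub_eq_zero] at h3
  · rintro rfl
    exact ⟨hmem, fun Y hY => by
      have := hkey Y hY
      simp only [Set.mem_ofPred_eq]
      nlinarith [sq_nonneg ‖Y - X‖]⟩

theorem isProxStep_of_update (G : SymMat n) (σ : ℝ) {X S Z S' Z' : SymMat n}
    (hS : S' = metricProj (psdCone n) (S - σ • X))
    (hZ : Z' = metricProj (nonnegCone n) (Z - σ • X)) :
    IsProxStep (sumMap n) G (dualFeasible n) σ (pair S Z) (X - G - S' - Z') (pair S' Z') := by
  have hS1 := isSelfDual_psdCone.metricProj_mem (S - σ • X)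
  have hZ1 := isSelfDual_nonnegCone.metricProj_mem (Z - σ • X)
  rw [← hS] at hS1
  rw [← hZ] at hZ1
  refine ⟨⟨hS1, hZ1⟩, fun c hc => ?_⟩
  have h1 := isSelfDual_psdCone.inner_sub_metricProj_le σ hS hc.1
  have h2 := isSelfDual_nonnegCone.inner_sub_metricProj_le σ hZ hc.2
  have hX : sumMap n (pair S' Z') + G + (X - G - S' - Z') = X := by
    change S' + Z' + G + (X - G - S' - Z') = X
    abel
  rw [hX, WithLp.prod_inner_apply, sumMap_apply, inner_add_right]
  change ⟪S - S', c.fst - S'⟫ + ⟪Z - Z', c.snd - Z'⟫ ≤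
    σ * (⟪X, c.fst - S'⟫ + ⟪X, c.snd - Z'⟫)
  linarith

theorem norm_kktRes_le (G : SymMat n) {σ : ℝ} (hσ : 0 < σ) {X S Z S' Z' : SymMat n}
    (hS : S' = metricProj (psdCone n) (S - σ • X))
    (hZ : Z' = metricProj (nonnegCone n) (Z - σ • X)) :
    ‖kktRes X S' Z' G‖ ≤ ‖X - G - S' - Z'‖ + ‖pair (S' - S) (Z' - Z)‖ / σ := by
  have h1 := isSelfDual_psdCone.norm_sub_metricProj_sub_le hσ hS
  have h2 := isSelfDual_nonnegCone.norm_sub_metricProj_sub_le hσ hZ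
  have h3 := pow_le_pow_left₀ (norm_nonneg _) h1 2
  have h4 := pow_le_pow_left₀ (norm_nonneg _) h2 2
  have h5 : ‖pair (S' - S) (Z' - Z)‖ ^ 2 = ‖S' - S‖ ^ 2 + ‖Z' - Z‖ ^ 2 :=
    WithLp.prod_norm_sq_eq_of_L2 _
  refine abs_le_of_sq_le_sq' ?_ (by positivity) |>.2
  rw [WithLp.prod_norm_sq_eq_of_L2, WithLp.prod_norm_sq_eq_of_L2]
  change ‖X - G - S' - Z'‖ ^ 2 + (‖X - metricProj (psdCone n) (X - S')‖ ^ 2 +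
    ‖X - metricProj (nonnegCone n) (X - Z')‖ ^ 2) ≤ _
  have h6 : (‖pair (S' - S) (Z' - Z)‖ / σ) ^ 2 = (‖S' - S‖ / σ) ^ 2 + (‖Z' - Z‖ / σ) ^ 2 := by
    rw [div_pow, h5, add_div, div_pow, div_pow]
  have h7 : 0 ≤ ‖X - G - S' - Z'‖ * (‖pair (S' - S) (Z' - Z)‖ / σ) := by positivity
  rw [add_sq, h6]
  linarith

end Matrices

/-! ### Limits of the rates; the hypothesis `hq` covers finite and infinite `σ∞` alike. -/

section Rates

theorem tendsto_mu {η σ : ℕ → ℝ} (κ : ℝ) (hη : Tendsto η atTop (𝓝 0)) {q : ℝ}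
    (hq : Tendsto (fun k => 1 / √(1 + σ k ^ 2 * κ ^ 2)) atTop (𝓝 q)) :
    Tendsto (fun k => mu κ (η k) (σ k)) atTop (𝓝 q) := by
  have h := (hη.add ((hη.add_const 1).mul hq)).div (hη.const_sub 1) (by norm_num)
  simp only [zero_add, one_mul, sub_zero, div_one] at h
  refine h.congr fun k => ?_
  simp only [mu, Pi.div_apply]
  ring

theorem tendsto_mu' {η σ : ℕ → ℝ} (hη : Tendsto η atTop (𝓝 0)) {q : ℝ}
    (hq : Tendsto (fun k => 1 / σ k) atTop (𝓝 q)) :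
    Tendsto (fun k => mu' (η k) (σ k)) atTop (𝓝 (2 * q)) := by
  have h := ((hη.mul hq.sqrt).add (hq.const_mul 2)).div (hη.const_sub 1) (by norm_num)
  simp only [zero_mul, zero_add, sub_zero, div_one] at h
  refine h.congr fun k => ?_
  simp only [mu', Pi.div_apply]
  rw [Real.sqrt_div zero_le_one, Real.sqrt_one]
  ring

end Rates

end DNN

end

/-! ### Convergence and rates of the augmented Lagrangian method. -/

open DNN in
theorem mainTheorem4 (n : ℕ) (G : DNN.SymMat n) (σ ε : ℕ → ℝ) (X S Z : ℕ → DNN.SymMat n)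
    (hσ_pos : ∀ k, 0 < σ k) (hσ_mono : Monotone σ)
    (hε_pos : ∀ k, 0 < ε k) (hε_sum : Summable ε)
    (hALM : DNN.IsALMUpdate σ X S Z) (hA : DNN.CriterionA G σ ε X S Z) :
    Bornology.IsBounded (Set.range fun k => (X k, S k, Z k)) ∧
    ∃ (Xinf Sinf Zinf : DNN.SymMat n),
      DNN.solP G = {Xinf} ∧
      Tendsto X atTop (𝓝 Xinf) ∧
      DNN.pair Sinf Zinf ∈ DNN.solD G ∧
      Tendsto (fun k => DNN.pair (S k) (Z k)) atTop (𝓝 (DNN.pair Sinf Zinf)) ∧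
      ∀ (η : ℕ → ℝ) (κ : ℝ), (∀ k, 0 < η k) → Summable η →
        DNN.CriterionB G σ η X S Z →
        DNN.DualQuadraticGrowth G (DNN.pair Sinf Zinf) κ →
        (∃ k₀ : ℕ, ∀ k ≥ k₀, η k < 1 ∧
          Metric.infDist (DNN.pair (S (k + 1)) (Z (k + 1))) (DNN.solD G) ≤
            DNN.mu κ (η k) (σ k) * Metric.infDist (DNN.pair (S k) (Z k)) (DNN.solD G) ∧
          ‖DNN.kktRes (X (k + 1)) (S (k + 1)) (Z (k + 1)) G‖ ≤
            DNN.mu' (η k) (σ k) * Metric.infDist (DNN.pair (S k) (Z k)) (DNN.solD G)) ∧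
        (∀ σinf : ℝ, Tendsto σ atTop (𝓝 σinf) →
          Tendsto (fun k => DNN.mu κ (η k) (σ k)) atTop (𝓝 (1 / √(1 + σinf ^ 2 * κ ^ 2))) ∧
          Tendsto (fun k => DNN.mu' (η k) (σ k)) atTop (𝓝 (2 / σinf))) ∧
        (Tendsto σ atTop atTop →
          Tendsto (fun k => DNN.mu κ (η k) (σ k)) atTop (𝓝 0) ∧
          Tendsto (fun k => DNN.mu' (η k) (σ k)) atTop (𝓝 0)) := by
  have hC := isSelfDual_dualFeasible (n := n)
  let e : ℕ → SymMat n := fun k => X (k + 1) - G - S (k + 1) - Z (k + 1)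
  have hgrad : ∀ k, gradient (augLag G (σ k) (S k) (Z k)) (X (k + 1)) = e k := fun k => by
    rw [gradient_augLag G (hσ_pos k).ne', ← (hALM k).1, ← (hALM k).2]
  have hsqrt : ∀ k, 0 < √(σ k) := fun k => Real.sqrt_pos.2 (hσ_pos k)
  have he : ∀ k, √(σ k) * ‖e k‖ ≤ ε k := fun k => by
    have := hA k
    rwa [hgrad, le_div_iff₀ (hsqrt k), mul_comm] at this
  have hstep : ∀ k, IsProxStep (sumMap n) G (dualFeasible n) (σ k) (pair (S k) (Z k)) (e k)
      (pair (S (k + 1)) (Z (k + 1))) := fun k =>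
    isProxStep_of_update G (σ k) (hALM k).1 (hALM k).2
  have hε0 := hε_sum.tendsto_atTop_zero
  have hse : Tendsto (fun k => √(σ k) * ‖e k‖) atTop (𝓝 0) :=
    squeeze_zero (fun k => by positivity) he hε0
  have he0 : Tendsto e atTop (𝓝 0) := by
    have h := hε0.div_const √(σ 0)
    rw [zero_div] at h
    refine squeeze_zero_norm (fun k => ?_) h
    rw [le_div_iff₀ (hsqrt 0), mul_comm]
    exact (mul_le_mul_of_nonneg_right (Real.sqrt_le_sqrt (hσ_mono (Nat.zero_le k)))
      (norm_nonneg _)).trans (he k)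
  have hsum : Summable fun k => σ k * ‖e k‖ ^ 2 := by
    refine Summable.of_nonneg_of_le (fun k => mul_nonneg (hσ_pos k).le (sq_nonneg _)) (fun k => ?_)
      (hε_sum.mul_left (∑' i, ε i))
    calc σ k * ‖e k‖ ^ 2 = (√(σ k) * ‖e k‖) ^ 2 := by rw [mul_pow, Real.sq_sqrt (hσ_pos k).le]
      _ ≤ ε k ^ 2 := pow_le_pow_left₀ (by positivity) (he k) 2
      -- One factor `ε k` is bounded by the whole sum, so the squares are summable.
      _ ≤ (∑' i, ε i) * ε k := by
          rw [sq]
          exact mul_le_mul_of_nonneg_right (hε_sum.le_tsum k fun i _ => (hε_pos i).le) (hε_pos k).le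
  obtain ⟨z, hz, hlim⟩ := exists_tendsto_of_isProxStep (B := sumMap n) (G := G)
    (y := fun k => pair (S k) (Z k)) hC.isClosed
    (solD_nonempty G) (hσ_pos 0) (fun k => hσ_mono (Nat.zero_le k)) hstep hsum
  have hXlim : Tendsto X atTop (𝓝 (sumMap n z + G)) := by
    -- `X 0` is unconstrained; from index `1` on, `X = S + Z + G + e`.
    rw [← tendsto_add_atTop_iff_nat 1]
    have h1 := (((sumMap n).continuous.tendsto z).comp
      ((tendsto_add_atTop_iff_nat 1).2 hlim)).add (he0.const_add G)
    rw [add_zero] at h1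
    refine h1.congr fun k => ?_
    change S (k + 1) + Z (k + 1) + (G + (X (k + 1) - G - S (k + 1) - Z (k + 1))) = X (k + 1)
    abel
  have hSlim : Tendsto S atTop (𝓝 z.fst) :=
    ((WithLp.continuous_fst 2 (SymMat n) (SymMat n)).tendsto z).comp hlim
  have hZlim : Tendsto Z atTop (𝓝 z.snd) :=
    ((WithLp.continuous_snd 2 (SymMat n) (SymMat n)).tendsto z).comp hlim
  refine ⟨Metric.isBounded_range_of_tendsto _ (hXlim.prodMk_nhds (hSlim.prodMk_nhds hZlim)),
    sumMap n z + G, z.fst, z.snd, solP_eq_singleton G hz, hXlim, hz, hlim, ?_⟩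
  intro η κ hη hηsum hB hQ
  obtain ⟨hκ, r, hr, hgrowth⟩ := hQ
  have hη0 := hηsum.tendsto_atTop_zero
  refine ⟨?_, fun σinf hσinf => ?_, fun hσinf => ?_⟩
  · have hball : ∀ᶠ k in atTop, √(σ k) * ‖e k‖ + ‖pair (S (k + 1)) (Z (k + 1)) - z‖ < r := by
      have h1 := hse.add (tendsto_iff_norm_sub_tendsto_zero.1
        ((tendsto_add_atTop_iff_nat 1).2 hlim))
      rw [add_zero] at h1
      exact h1.eventually_lt_const hr
    obtain ⟨k₀, hk₀⟩ := eventually_atTop.1 (hball.and (hη0.eventually_lt_const one_pos))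
    refine ⟨k₀, fun k hk => ?_⟩
    obtain ⟨hkr, hk1⟩ := hk₀ k hk
    have hdiff : ‖pair (S (k + 1) - S k) (Z (k + 1) - Z k)‖ =
      ‖pair (S (k + 1)) (Z (k + 1)) - pair (S k) (Z k)‖ := rfl
    have hBk := hB k
    rw [hgrad] at hBk
    have heη : √(σ k) * ‖e k‖ ≤ η k * ‖pair (S (k + 1)) (Z (k + 1)) - pair (S k) (Z k)‖ := by
      rw [div_mul_eq_mul_div, le_div_iff₀ (hsqrt k), mul_comm, hdiff] at hBk
      exact hBk
    obtain ⟨h1, h2⟩ := (hstep k).infDist_le_mu hC.convex hC.isClosed (hσ_pos k) hκ (hη k) hk1 hz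
      hgrowth hkr.le heη
    refine ⟨hk1, h2, (norm_kktRes_le G (hσ_pos k) (hALM k).1 (hALM k).2).trans ?_⟩
    have hk1' : 0 < 1 - η k := sub_pos.2 hk1
    rw [quadSol_sumMap, ← hdiff] at h1
    set t := ‖pair (S (k + 1) - S k) (Z (k + 1) - Z k)‖
    have ht : 0 ≤ t := norm_nonneg _
    have hσk := hσ_pos k
    have hsk := hsqrt k
    have hηk := hη k
    calc ‖e k‖ + t / σ k ≤ η k / √(σ k) * t + t / σ k := by gcongr
      -- The argument gives `1/σ`; the stated constant `2/σ` is weaker.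
      _ ≤ (η k / √(σ k) + 2 / σ k) * t := by
          have : 0 ≤ t / σ k := by positivity
          rw [add_mul, div_mul_eq_mul_div 2, mul_div_assoc 2]
          linarith
      _ = mu' (η k) (σ k) * ((1 - η k) * t) := by
          unfold mu'
          field_simp
      _ ≤ _ := by
          refine mul_le_mul_of_nonneg_left h1 ?_
          unfold mu'
          positivity
  · have hpos : 0 < σinf := (hσ_pos 0).trans_le (hσ_mono.ge_of_tendsto hσinf 0)
    refine ⟨tendsto_mu κ hη0 ?_, ?_⟩
    · refine tendsto_const_nhds.div (((hσinf.pow 2).mul_const _).const_add 1).sqrt ?_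
      positivity
    · have := tendsto_mu' hη0 (tendsto_const_nhds.div hσinf hpos.ne' :
        Tendsto (fun k => 1 / σ k) atTop (𝓝 (1 / σinf)))
      rwa [mul_one_div] at this
  · refine ⟨tendsto_mu κ hη0 ?_, ?_⟩
    · refine tendsto_const_nhds.div_atTop (Real.tendsto_sqrt_atTop.comp ?_)
      refine tendsto_atTop_add_const_left _ _ ?_
      exact ((tendsto_pow_atTop two_ne_zero).comp hσinf).atTop_mul_const (by positivity)
    · have := tendsto_mu' hη0 (tendsto_const_nhds.div_atTop hσinf :
        Tendsto (fun k => 1 / σ k) atTop (𝓝 0))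
      rwa [mul_zero] at this
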